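/- Theorem 3.2. Let $n,m\ge 0$ and $N\ge 2$ be integers, $f(\cdot,t):\mathbb R^n\to\mathbb R\cup\{\pm\infty\}$, $W_k:\mathbb R^{3n}\to\mathbb R$ ($k\in I=\{1,\dots,m\}$), $\bar v_0,\bar v_1\in\mathbb R^n$, and consider the (in general nonconvex) problem $$(PD)\qquad \text{minimize }\sum_{t=2}^{N-1} f(x_t,t)\quad\text{subject to}\quad W_k(x_t,x_{t+1},x_{t+2})\le 0\ \ (t=0,\dots,N-2,\ k\in I),\qquad x_0=\bar v_0,\ x_1=\bar v_1 .$$ Let $\{\tilde x_t\}_{t=0}^N$ be an optimal trajectory, that is, a minimizer among all sequences satisfying the constraints. Put $\tilde z_t=(\tilde x_t,\tilde x_{t+1},\tilde x_{t+2})$, $I_t=\{k\in I: W_k(\tilde z_t)=0\}$ and $F=\{z\in\mathbb R^{3n}: W_k(z)\le 0,\ k\in I\}$. Definitions. A nonempty convex cone $K$ is a *cone of tangent directions* to a set $A$ at $z_0\in A$ if for every $\bar z\in K$ there is a function $\varphi$ with $\lambda^{-1}\varphi(\lambda)\to0$ as $\lambda\downarrow0$ and $z_0+\lambda\bar z+\varphi(\lambda)\in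 A$ for all small $\lambda>0$. It is a *local tent* if moreover for every $\bar z_0\in\operatorname{ri}K$ there are a convex cone $K'\subseteq K$ with $\bar z_0\in\operatorname{ri}K'$ and $\operatorname{Lin}K'=\operatorname{Lin}K$, a continuous mapping $\gamma$ defined in a neighbourhood of the origin with $\gamma(\bar z)=\bar z+o(\|\bar z\|)$ as $\bar z\to0$, and $\varepsilon>0$, such that $z_0+\gamma(\bar z)\in A$ for all $\bar z\in K'$ with $\|\bar z\|<\varepsilon$. A *continuous convex upper approximation* (CUA) of a function $W$ with values in $\mathbb R\cup\{\pm\infty\}$ at a point $z$ where $W$ is finite is a finite continuous convex function $h$ with $h(\lambda\bar z)=\lambda h(\bar z)$ for $\lambda>0$ and $$h(\bar z)\ \ge\ \sup_{r(\cdot)}\limsup_{\lambda\downarrow0}\tfrac1\lambda\bigl[W(z+\lambda\bar z+r(\lambda))-W(z)\bigr]\quad\text{for all }\bar z\ne0,$$ the supremum being over all $r$ with $\lambda^{-1}r(\lambda)\to0$ as $\lambda\downarrow0$. The subdifferential of $W$ at $z$ defined by $h$ is $\partial W(z)=\partial h(0)=\{z^*: h(\bar z)\ge\langle\bar z,z^*\rangle\text{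 for all }\bar z\}$. Assume that: 1. for each $t=0,\dots,N-2$ a cone of tangent directions $K_F(\tilde z_t)$ to $F$ at $\tilde z_t$ is given which is a local tent; 2. for each $t=0,\dots,N-2$, every $W_k$ with $k\in I_t$ has a continuous CUA $h^t_{W_k}$ at $\tilde z_t$, which defines $\partial W_k(\tilde z_t)$, and every $W_k$ with $k\notin I_t$ is upper semicontinuous at $\tilde z_t$ (for example, continuous); 3. $f(\cdot,N-1)$ has a continuous CUA $h_{N-1}$ at $\tilde x_{N-1}$, which defines $\partial f(\tilde x_{N-1},N-1)$; 4. $f(\cdot,t)$ is real-valued and continuously differentiable (not necessarily convex) for $t=2,\dots,N-2$; 5. for each $t=0,\dots,N-2$ there is $\bar z\in\mathbb R^{3n}$ with $h^t_{W_k}(\bar z)<0$ for all $k\in I_t$. Then there exist numbers $\mu\ge0$ and $\alpha_t^k\ge0$ ($t=0,\dots,N-2$, $k\in I$) and vectors $x_t^*$ ($t=0,\dots,N$), $u_t^*$ ($t=0,\dots,N-1$) in $\mathbb R^n$ such that $\mu$, the $\alpha^k_t$ with $2\le t\le N-2$, the $x^*_t$ and the $u^*_t$ are not all zero, and, for $t=0,\dots,N-2$,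 $$\bigl(x_t^*-u_t^*-\mu f'_x(\tilde x_t,t),\ u_{t+1}^*,\ -x_{t+2}^*\bigr)\in\sum_{k\in I_t}\alpha_t^k\,\partial W_k(\tilde z_t),\qquad \alpha_t^kW_k(\tilde z_t)=0\quad(k\in I),$$ where $f'_x(\tilde x_0,0)$ and $f'_x(\tilde x_1,1)$ are understood to be $0$, together with $$u_0^*=0,\qquad x_{N-1}^*-u_{N-1}^*\in\mu\,\partial f(\tilde x_{N-1},N-1),\qquad x_N^*=0 .$$ -/

import Mathlib

open Set Filter Topology
open scoped Pointwise

noncomputable section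

namespace DiscreteIneq

/-- The Euclidean space `ℝⁿ`. -/
abbrev Vec (n : ℕ) : Type := EuclideanSpace ℝ (Fin n)

/-- The space `ℝ³ⁿ` of triples `z = (x, v₁, v₂)`, with its usual topology. -/
abbrev Triple (n : ℕ) : Type := Vec n × Vec n × Vec n

/-- The Euclidean inner product of `ℝ³ⁿ`. -/
def pair {n : ℕ} (z w : Triple n) : ℝ :=
  inner ℝ z.1 w.1 + inner ℝ z.2.1 w.2.1 + inner ℝ z.2.2 w.2.2

/-! ### Tangent directions and local tents -/

/-- `d` is a tangent vector to `A` at `z₀`: there is `φ` with `φ(s) / s → 0` as `s ↓ 0` and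
`z₀ + s d + φ(s) ∈ A` for all sufficiently small `s > 0`. -/
def IsTangentVector {F : Type*} [NormedAddCommGroup F] [NormedSpace ℝ F]
    (A : Set F) (z₀ d : F) : Prop :=
  ∃ φ : ℝ → F, Tendsto (fun s : ℝ => s⁻¹ • φ s) (𝓝[>] 0) (𝓝 0) ∧
    ∀ᶠ s in 𝓝[>] (0 : ℝ), z₀ + s • d + φ s ∈ A

/-- `K` is a (not necessarily the largest) cone of tangent directions to `A` at `z₀`: a nonempty
convex cone consisting of tangent vectors. -/
def IsTangentCone {F : Type*} [NormedAddCommGroup F] [NormedSpace ℝ F]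
    (A : Set F) (z₀ : F) (K : ConvexCone ℝ F) : Prop :=
  (K : Set F).Nonempty ∧ ∀ d ∈ K, IsTangentVector A z₀ d

/-- The cone of tangent directions `K` to `A` at `z₀` is a local tent. -/
def IsLocalTent {F : Type*} [NormedAddCommGroup F] [NormedSpace ℝ F]
    (A : Set F) (z₀ : F) (K : ConvexCone ℝ F) : Prop :=
  IsTangentCone A z₀ K ∧
  ∀ d ∈ intrinsicInterior ℝ (K : Set F),
    ∃ (K' : ConvexCone ℝ F) (γ : F → F) (U : Set F),
      K' ≤ K ∧
      U ∈ 𝓝 (0 : F) ∧ ContinuousOn γ U ∧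
      d ∈ intrinsicInterior ℝ (K' : Set F) ∧
      Submodule.span ℝ (K' : Set F) = Submodule.span ℝ (K : Set F) ∧
      (fun z => γ z - z) =o[𝓝 0] (fun z : F => z) ∧
      ∃ ε > 0, Metric.ball (0 : F) ε ⊆ U ∧
        ∀ z ∈ (K' : Set F) ∩ Metric.ball 0 ε, z₀ + γ z ∈ A

/-! ### Convex upper approximations -/

/-- `V(d, z) = sup_r limsup_{s ↓ 0} (W (z + s d + r(s)) - W z) / s`, the supremum being over all
`r` with `r(s) / s → 0` as `s ↓ 0`. -/
def upperDeriv {F : Type*} [NormedAddCommGroup F] [NormedSpace ℝ F]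
    (W : F → EReal) (z d : F) : EReal :=
  ⨆ r ∈ {r : ℝ → F | Tendsto (fun s : ℝ => s⁻¹ • r s) (𝓝[>] 0) (𝓝 0)},
    limsup (fun s : ℝ => ((s⁻¹ : ℝ) : EReal) * (W (z + s • d + r s) - W z)) (𝓝[>] 0)

/-- The finite function `h` is a continuous convex upper approximation (CUA) of `W` at a point `z`
where `W` is finite. -/
structure IsContinuousCUA {F : Type*} [NormedAddCommGroup F] [NormedSpace ℝ F]
    (W : F → EReal) (z : F) (h : F → ℝ) : Prop where
  finite_at : W z ≠ ⊤ ∧ W z ≠ ⊥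
  upperDeriv_le : ∀ d, d ≠ 0 → upperDeriv W z d ≤ (h d : EReal)
  convex : ConvexOn ℝ univ h
  pos_homogeneous : ∀ c : ℝ, 0 < c → ∀ d, h (c • d) = c * h d
  continuous : Continuous h

/-- `∂h(0)` for a function `h` on `ℝⁿ`; if `h` is a CUA of `f` at `x`, this is the
subdifferential `∂f(x)` defined by `h`. -/
def subdiff {n : ℕ} (h : Vec n → ℝ) : Set (Vec n) :=
  {p | ∀ d, inner ℝ d p ≤ h d}

/-- `∂h(0)` for a function `h` on `ℝ³ⁿ`; if `h` is a CUA of `W` at `z`, this is the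
subdifferential `∂W(z)` defined by `h`. -/
def subdiffTriple {n : ℕ} (h : Triple n → ℝ) : Set (Triple n) :=
  {p | ∀ d, pair d p ≤ h d}

/-! ### The discrete problem -/

/-- An extended real valued function that is finite everywhere and continuously differentiable. -/
def IsRealC1 {n : ℕ} (φ : Vec n → EReal) : Prop :=
  (∀ x, φ x ≠ ⊤ ∧ φ x ≠ ⊥) ∧ ContDiff ℝ 1 (fun x => (φ x).toReal)

/-- The triple `(x_t, x_{t+1}, x_{t+2})` of a sequence. -/
def tri {n : ℕ} (x : ℕ → Vec n) (t : ℕ) : Triple n := (x t, x (t + 1), x (t + 2))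

/-- `F = {z : W_k(z) ≤ 0 for all k}`. -/
def constraintSet {n m : ℕ} (W : Fin m → Triple n → ℝ) : Set (Triple n) :=
  {z | ∀ k, W k z ≤ 0}

/-- The active indices `I(z) = {k : W_k(z) = 0}`. -/
def active {n m : ℕ} (W : Fin m → Triple n → ℝ) (z : Triple n) : Finset (Fin m) :=
  {k | W k z = 0}

/-- `x_0, …, x_N` is a feasible trajectory: the second order inequalities hold for
`t = 0, …, N - 2` and `x_0, x_1` are the prescribed initial values.
(Only the entries of index at most `N` of the sequence `x` matter.) -/
def IsFeasible {n m : ℕ} (N : ℕ) (W : Fin m → Triple n → ℝ) (v₀ v₁ : Vec n)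
    (x : ℕ → Vec n) : Prop :=
  x 0 = v₀ ∧ x 1 = v₁ ∧ ∀ t, t + 2 ≤ N → ∀ k, W k (tri x t) ≤ 0

/-- The cost `∑_{t=2}^{N-1} f(x_t, t)`. -/
def cost {n : ℕ} (N : ℕ) (f : ℕ → Vec n → EReal) (x : ℕ → Vec n) : EReal :=
  ∑ t ∈ Finset.Icc 2 (N - 1), f t (x t)

/-- An optimal trajectory: feasible, and of least cost among the feasible trajectories. -/
def IsOptimal {n m : ℕ} (N : ℕ) (f : ℕ → Vec n → EReal) (W : Fin m → Triple n → ℝ)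
    (v₀ v₁ : Vec n) (x : ℕ → Vec n) : Prop :=
  IsFeasible N W v₀ v₁ x ∧ ∀ y, IsFeasible N W v₀ v₁ y → cost N f x ≤ cost N f y

/-- The gradient `f'_x(x_t, t)`, with the convention that it is zero for `t = 0, 1` (the cost has
no terms of these indices). -/
def stageGrad {n : ℕ} (f : ℕ → Vec n → EReal) (x : ℕ → Vec n) (t : ℕ) : Vec n :=
  if t < 2 then 0 else gradient (fun y => (f t y).toReal) (x t)

end DiscreteIneq

end

open DiscreteIneq

/-! The argument uses straight-line variations `x + s • d` of the trajectory with `d 0 = d 1 = 0`.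
If some `d` made every active `h t k` negative and the directional bound on the cost negative, then
for small `s > 0` the varied trajectory would be feasible (`eventually_isFeasible`) and strictly
cheaper (`eventually_cost_lt`), contradicting optimality.

So for every `d` one of finitely many sublinear functions is nonnegative. Each is the maximum of a
compact convex set of functionals (`exists_mem_dualSubdiff_apply_eq`), and separating `0` from the
convex hull of these sets shows that `0` lies in the hull
(`exists_multipliers_of_forall_exists_nonneg`). The weights are `μ` and `α`.

Testing this relation on variations supported at one index gives an Euler equation at each index
from `2` to `N` (`stationarity`). The adjoint vectors are the components of the combined
subgradients `A t`. If `μ` and all adjoint vectors vanished, every `A t` would be zero, and the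
Slater directions would force `α = 0`. -/

open Set Filter Topology
open scoped Pointwise
open DiscreteIneq

/-! ### Sublinear functions and their subdifferentials in the dual -/

section SublinearFunctions

variable {E : Type*} [NormedAddCommGroup E] [NormedSpace ℝ E]

/-- The subdifferential at the origin, as a subset of the dual space. -/
def dualSubdiff (h : E → ℝ) : Set (StrongDual ℝ E) := {φ | ∀ d, φ d ≤ h d}

theorem convex_dualSubdiff (h : E → ℝ) : Convex ℝ (dualSubdiff h) := by
  intro φ hφ ψ hψ a b ha hb hab d
  have h1 := mul_le_mul_of_nonneg_left (hφ d) ha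
  have h2 := mul_le_mul_of_nonneg_left (hψ d) hb
  have h3 : a * h d + b * h d = h d := by rw [← add_mul, hab, one_mul]
  simp only [add_apply, smul_apply, smul_eq_mul]
  linarith

theorem isClosed_dualSubdiff (h : E → ℝ) : IsClosed (dualSubdiff h) := by
  have : dualSubdiff h = ⋂ d, {φ : StrongDual ℝ E | φ d ≤ h d} := by
    ext φ; simp [dualSubdiff]
  rw [this]
  refine isClosed_iInter fun d => isClosed_le ?_ continuous_const
  exact (ContinuousLinearMap.apply ℝ ℝ d).continuous

theorem map_zero_of_pos_homogeneous {h : E → ℝ}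
    (hom : ∀ c : ℝ, 0 < c → ∀ d, h (c • d) = c * h d) : h 0 = 0 := by
  have := hom 2 (by norm_num) 0
  rw [smul_zero] at this
  linarith

theorem subadditive_of_convexOn {h : E → ℝ} (hc : ConvexOn ℝ univ h)
    (hom : ∀ c : ℝ, 0 < c → ∀ d, h (c • d) = c * h d) (a b : E) : h (a + b) ≤ h a + h b := by
  have h1 := hc.2 (mem_univ a) (mem_univ b) (show (0 : ℝ) ≤ 1 / 2 by norm_num)
    (show (0 : ℝ) ≤ 1 / 2 by norm_num) (by norm_num)
  rw [← smul_add, hom _ (by norm_num), smul_eq_mul, smul_eq_mul] at h1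
  linarith

variable [FiniteDimensional ℝ E]

/-- Hahn–Banach: the functional `c • d ↦ c * h d` on the line through `d` is dominated by `h`; for
`c < 0` this is `0 = h 0 ≤ h (c • d) + h (-c • d)`. -/
theorem exists_mem_dualSubdiff_apply_eq {h : E → ℝ} (hc : ConvexOn ℝ univ h)
    (hom : ∀ c : ℝ, 0 < c → ∀ d, h (c • d) = c * h d) (d : E) :
    ∃ φ ∈ dualSubdiff h, φ d = h d := by
  have h0 := map_zero_of_pos_homogeneous hom
  have hsub := subadditive_of_convexOn hc hom
  have H : ∀ c : ℝ, c • d = 0 → c • h d = 0 := by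
    intro c hcd
    rcases smul_eq_zero.1 hcd with rfl | rfl
    · simp
    · simp [h0]
  obtain ⟨g, hg, hle⟩ := exists_extension_of_le_sublinear
    (LinearPMap.mkSpanSingleton' (σ := RingHom.id ℝ) d (h d) H) h hom hsub (by
      rintro ⟨y, hy⟩
      obtain ⟨c, rfl⟩ := Submodule.mem_span_singleton.1 hy
      rw [LinearPMap.mkSpanSingleton'_apply]
      simp only [RingHom.id_apply, smul_eq_mul]
      rcases lt_trichotomy c 0 with hneg | rfl | hpos
      · have h1 := hom (-c) (by linarith) d
        have h2 := hsub (c • d) ((-c) • d)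
        rw [← add_smul, add_neg_cancel, zero_smul, h0, h1] at h2
        linarith
      · simp [h0]
      · rw [hom c hpos])
  refine ⟨LinearMap.toContinuousLinearMap g, hle, ?_⟩
  have hmem : d ∈ (LinearPMap.mkSpanSingleton' (σ := RingHom.id ℝ) d (h d) H).domain :=
    Submodule.mem_span_singleton_self d
  have := hg ⟨d, hmem⟩
  rw [LinearPMap.mkSpanSingleton'_apply_self] at this
  exact this

theorem isCompact_dualSubdiff {h : E → ℝ} (hcont : Continuous h)
    (hom : ∀ c : ℝ, 0 < c → ∀ d, h (c • d) = c * h d) : IsCompact (dualSubdiff h) := by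
  refine Metric.isCompact_of_isClosed_isBounded (isClosed_dualSubdiff h) ?_
  obtain ⟨M, hM⟩ := (isCompact_closedBall (0 : E) 1).bddAbove_image hcont.continuousOn
  have hM' : ∀ d : E, ‖d‖ ≤ 1 → h d ≤ M := fun d hd =>
    hM ⟨d, by simpa using hd, rfl⟩
  have hM0 : 0 ≤ M := by
    simpa [map_zero_of_pos_homogeneous hom] using hM' 0 (by simp)
  refine (Metric.isBounded_iff_subset_closedBall 0).2 ⟨M, fun φ hφ => ?_⟩
  rw [mem_closedBall_zero_iff]
  refine ContinuousLinearMap.opNorm_le_of_unit_norm hM0 fun d hd => ?_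
  rw [Real.norm_eq_abs, abs_le]
  have h1 := (hφ d).trans (hM' d hd.le)
  have h2 := (hφ (-d)).trans (hM' (-d) (by rw [norm_neg, hd]))
  rw [map_neg] at h2
  exact ⟨by linarith, h1⟩

end SublinearFunctions

/-! ### Convex hulls and the theorem of the alternative -/

theorem Convex.exists_smul_eq_sum {E : Type*} [AddCommGroup E] [Module ℝ E] {S : Set E}
    (hS : Convex ℝ S) (hne : S.Nonempty) {κ : Type*} (t : Finset κ) (w : κ → ℝ) (z : κ → E)
    (hw : ∀ j ∈ t, 0 ≤ w j) (hz : ∀ j ∈ t, z j ∈ S) :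
    ∃ y ∈ S, (∑ j ∈ t, w j) • y = ∑ j ∈ t, w j • z j := by
  rcases (Finset.sum_nonneg hw).eq_or_lt with h0 | hpos
  · obtain ⟨y, hy⟩ := hne
    refine ⟨y, hy, ?_⟩
    have := (Finset.sum_eq_zero_iff_of_nonneg hw).1 h0.symm
    rw [← h0, zero_smul, Finset.sum_eq_zero fun j hj => by rw [this j hj, zero_smul]]
  · refine ⟨t.centerMass w z, hS.centerMass_mem hw hpos hz, ?_⟩
    rw [Finset.centerMass, smul_smul, mul_inv_cancel₀ hpos.ne', one_smul]

/-- Points of a convex combination lying in the same `S i` merge into one. For compact `S i` this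
exhibits the hull as a continuous image of a compact set, hence closed. -/
theorem convexHull_iUnion_eq_image {E : Type*} [AddCommGroup E] [Module ℝ E] {ι : Type*}
    [Fintype ι] {S : ι → Set E} (hconv : ∀ i, Convex ℝ (S i)) (hne : ∀ i, (S i).Nonempty) :
    convexHull ℝ (⋃ i, S i) =
      (fun p : (ι → ℝ) × (ι → E) => ∑ i, p.1 i • p.2 i) '' (stdSimplex ℝ ι ×ˢ univ.pi S) := by
  have : DecidableEq ι := Classical.decEq ι
  refine Subset.antisymm (fun y hy => ?_) ?_
  · obtain ⟨κ, _, w, z, hw, hw1, hz, rfl⟩ := mem_convexHull_iff_exists_fintype.1 hy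
    choose c hc using fun j => mem_iUnion.1 (hz j)
    have key : ∀ i, ∃ φ ∈ S i,
        (∑ j with c j = i, w j) • φ = ∑ j with c j = i, w j • z j := fun i =>
      (hconv i).exists_smul_eq_sum (hne i) _ w z (fun j _ => hw j)
        (fun j hj => by rw [← (Finset.mem_filter.1 hj).2]; exact hc j)
    choose φ hφ hsum using key
    refine ⟨(fun i => ∑ j with c j = i, w j, φ),
      ⟨⟨fun i => Finset.sum_nonneg fun j _ => hw j, ?_⟩, fun i _ => hφ i⟩, ?_⟩
    · exact (Finset.sum_fiberwise _ c w).trans hw1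
    · simp only [hsum]
      exact Finset.sum_fiberwise _ c fun j => w j • z j
  · rintro _ ⟨⟨w, φ⟩, ⟨hw, hφ⟩, rfl⟩
    exact mem_convexHull_of_exists_fintype w φ hw.1 hw.2
      (fun i => mem_iUnion.2 ⟨i, hφ i (mem_univ i)⟩) rfl

/-- Theorem of the alternative for finitely many compact convex sets of functionals. -/
theorem exists_multipliers_of_forall_exists_nonneg {V : Type*} [NormedAddCommGroup V]
    [NormedSpace ℝ V] [FiniteDimensional ℝ V] {ι : Type*} [Fintype ι]
    {S : ι → Set (StrongDual ℝ V)} (hconv : ∀ i, Convex ℝ (S i))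
    (hcomp : ∀ i, IsCompact (S i)) (hne : ∀ i, (S i).Nonempty)
    (halt : ∀ d : V, ∃ i, ∃ φ ∈ S i, 0 ≤ φ d) :
    ∃ w ∈ stdSimplex ℝ ι, ∃ φ : ι → StrongDual ℝ V, (∀ i, φ i ∈ S i) ∧ ∑ i, w i • φ i = 0 := by
  have hC : IsCompact (convexHull ℝ (⋃ i, S i)) := by
    rw [convexHull_iUnion_eq_image hconv hne]
    exact ((isCompact_stdSimplex ℝ ι).prod (isCompact_univ_pi hcomp)).image (by fun_prop)
  have h0 : (0 : StrongDual ℝ V) ∈ convexHull ℝ (⋃ i, S i) := by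
    by_contra hnot
    obtain ⟨F, u, hF, hu⟩ :=
      geometric_hahn_banach_closed_point (convex_convexHull ℝ _) hC.isClosed hnot
    rw [map_zero] at hu
    -- By finite dimensionality the separating functional is evaluation at some `d`; every `φ` in
    -- every `S i` is then negative at `d`, against `halt`.
    let G : Module.Dual ℝ (Module.Dual ℝ V) :=
      F.toLinearMap ∘ₗ (LinearMap.toContinuousLinearMap : (V →ₗ[ℝ] ℝ) ≃ₗ[ℝ] V →L[ℝ] ℝ).toLinearMap
    obtain ⟨d, hd⟩ := (Module.evalEquiv ℝ V).surjective G
    obtain ⟨i, φ, hφ, hφd⟩ := halt d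
    have h1 := hF φ (subset_convexHull ℝ _ (mem_iUnion.2 ⟨i, hφ⟩))
    have h2 : φ d = F φ := by
      have := congrArg (fun T : Module.Dual ℝ (Module.Dual ℝ V) => T φ.toLinearMap) hd
      simpa [G] using! this
    linarith
  rw [convexHull_iUnion_eq_image hconv hne] at h0
  obtain ⟨⟨w, φ⟩, ⟨hw, hφ⟩, hsum⟩ := h0
  exact ⟨w, hw, φ, fun i => hφ i (mem_univ i), hsum⟩

/-- A version of `exists_multipliers_of_forall_exists_nonneg` for a finite part of a family. -/
theorem exists_multipliers_finset {V : Type*} [NormedAddCommGroup V]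
    [NormedSpace ℝ V] [FiniteDimensional ℝ V] {ι : Type*} (J : Finset ι)
    {S : ι → Set (StrongDual ℝ V)} (hconv : ∀ i ∈ J, Convex ℝ (S i))
    (hcomp : ∀ i ∈ J, IsCompact (S i)) (hne : ∀ i ∈ J, (S i).Nonempty)
    (halt : ∀ d : V, ∃ i ∈ J, ∃ φ ∈ S i, 0 ≤ φ d) :
    ∃ (w : ι → ℝ) (φ : ι → StrongDual ℝ V), (∀ i, 0 ≤ w i) ∧ (∃ i ∈ J, w i ≠ 0) ∧
      (∀ i ∈ J, φ i ∈ S i) ∧ ∑ i ∈ J, w i • φ i = 0 := by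
  classical
  obtain ⟨w, hw, φ, hφ, hsum⟩ := exists_multipliers_of_forall_exists_nonneg
    (S := fun i : J => S i) (fun i => hconv i i.2) (fun i => hcomp i i.2) (fun i => hne i i.2)
    (fun d => by
      obtain ⟨i, hi, φ, hφ⟩ := halt d
      exact ⟨⟨i, hi⟩, φ, hφ⟩)
  refine ⟨fun i => if hi : i ∈ J then w ⟨i, hi⟩ else 0, fun i => if hi : i ∈ J then φ ⟨i, hi⟩ else 0,
    fun i => ?_, ?_, fun i hi => ?_, ?_⟩
  · dsimp only
    split_ifs with hi
    exacts [hw.1 _, le_rfl]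
  · by_contra! hall
    have hz : ∀ i : J, w i = 0 := fun i => by simpa using hall i i.2
    have := hw.2
    simp [hz] at this
  · simpa [hi] using hφ ⟨i, hi⟩
  · rw [← Finset.sum_coe_sort]
    simpa using hsum

/-! ### Feasibility and descent along straight lines -/

section Descent

variable {E : Type*} [NormedAddCommGroup E] [NormedSpace ℝ E]

/-- The correction `r = 0` in the supremum suffices. At `d = 0`, where a CUA gives no bound, `h 0 =
0 < c` does the work. -/
theorem DiscreteIneq.IsContinuousCUA.eventually_le {W : E → EReal} {z : E} {h : E → ℝ}
    (hW : IsContinuousCUA W z h) {d : E} {c : ℝ} (hc : h d < c) :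
    ∀ᶠ s in 𝓝[>] (0 : ℝ), W (z + s • d) ≤ W z + ((s * c : ℝ) : EReal) := by
  obtain ⟨a, ha⟩ : ∃ a : ℝ, W z = a :=
    ⟨(W z).toReal, (EReal.coe_toReal hW.finite_at.1 hW.finite_at.2).symm⟩
  rcases eq_or_ne d 0 with rfl | hd
  · rw [map_zero_of_pos_homogeneous hW.pos_homogeneous] at hc
    filter_upwards [self_mem_nhdsWithin] with s (hs : 0 < s)
    rw [smul_zero, add_zero, ha, ← EReal.coe_add, EReal.coe_le_coe_iff]
    linarith [mul_pos hs hc]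
  · have h1 : limsup (fun s : ℝ => ((s⁻¹ : ℝ) : EReal) * (W (z + s • d + (0 : ℝ → E) s) - W z))
        (𝓝[>] 0) ≤ upperDeriv W z d := by
      unfold upperDeriv
      exact le_iSup₂_of_le (0 : ℝ → E) (by simp) le_rfl
    have h2 := (h1.trans (hW.upperDeriv_le d hd)).trans_lt (EReal.coe_lt_coe_iff.2 hc)
    filter_upwards [eventually_lt_of_limsup_lt h2, self_mem_nhdsWithin] with s hlt (hs : 0 < s)
    simp only [Pi.zero_apply, add_zero, ha] at hlt
    rw [ha]
    generalize W (z + s • d) = y at hlt ⊢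
    induction y with
    | bot => exact bot_le
    | top =>
      rw [EReal.top_sub_coe, EReal.coe_mul_top_of_pos (inv_pos.2 hs)] at hlt
      exact absurd hlt not_top_lt
    | coe y =>
      rw [← EReal.coe_sub, ← EReal.coe_mul, EReal.coe_lt_coe_iff, inv_mul_lt_iff₀ hs] at hlt
      rw [← EReal.coe_add, EReal.coe_le_coe_iff]
      linarith

theorem eventually_lt_add_mul_of_hasDerivAt {R : ℝ → ℝ} {D c : ℝ} (hR : HasDerivAt R D 0)
    (hc : D < c) : ∀ᶠ s in 𝓝[>] (0 : ℝ), R s < R 0 + s * c := by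
  have h1 := hR.tendsto_slope_zero_right.eventually_lt_const hc
  filter_upwards [h1, self_mem_nhdsWithin] with s hlt (hs : 0 < s)
  rw [zero_add, smul_eq_mul, inv_mul_lt_iff₀ hs] at hlt
  linarith

theorem UpperSemicontinuousAt.eventually_neg_along {W : E → ℝ} {z : E}
    (hW : UpperSemicontinuousAt W z) (hz : W z < 0) (d : E) :
    ∀ᶠ s in 𝓝[>] (0 : ℝ), W (z + s • d) < 0 := by
  have ht : Tendsto (fun s : ℝ => z + s • d) (𝓝[>] 0) (𝓝 z) := by
    have : Continuous fun s : ℝ => z + s • d := by fun_prop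
    have h := this.tendsto 0
    rw [zero_smul, add_zero] at h
    exact h.mono_left nhdsWithin_le_nhds
  exact ht.eventually (hW 0 hz)

end Descent

theorem tri_add_smul {n : ℕ} (x y : ℕ → Vec n) (s : ℝ) (t : ℕ) :
    tri (fun r => x r + s • y r) t = tri x t + s • tri y t := rfl

theorem eventually_isFeasible {n m N : ℕ} {W : Fin m → Triple n → ℝ} {v₀ v₁ : Vec n}
    {x : ℕ → Vec n} (hx : IsFeasible N W v₀ v₁ x) {h : ℕ → Fin m → Triple n → ℝ}
    (hW : ∀ t, t + 2 ≤ N → ∀ k ∈ active W (tri x t),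
      IsContinuousCUA (fun z => ((W k z : ℝ) : EReal)) (tri x t) (h t k))
    (hWusc : ∀ t, t + 2 ≤ N → ∀ k ∉ active W (tri x t), UpperSemicontinuousAt (W k) (tri x t))
    {y : ℕ → Vec n} (hy0 : y 0 = 0) (hy1 : y 1 = 0)
    (hy : ∀ t, t + 2 ≤ N → ∀ k ∈ active W (tri x t), h t k (tri y t) < 0) :
    ∀ᶠ s in 𝓝[>] (0 : ℝ), IsFeasible N W v₀ v₁ fun t => x t + s • y t := by
  have key : ∀ᶠ s in 𝓝[>] (0 : ℝ), ∀ t ∈ Finset.range (N - 1), ∀ k : Fin m,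
      W k (tri x t + s • tri y t) ≤ 0 := by
    refine (Filter.eventually_all_finset _).2 fun t ht => Filter.eventually_all.2 fun k => ?_
    have ht : t + 2 ≤ N := by rw [Finset.mem_range] at ht; omega
    by_cases hk : k ∈ active W (tri x t)
    · have hzero : W k (tri x t) = 0 := by simpa [active] using hk
      -- Here the slope bound is `c = 0`.
      filter_upwards [(hW t ht k hk).eventually_le (hy t ht k hk)] with s hs
      simpa [hzero] using hs
    · have hne : W k (tri x t) ≠ 0 := by simpa [active] using hk
      filter_upwards [(hWusc t ht k hk).eventually_neg_along
        (lt_of_le_of_ne (hx.2.2 t ht k) hne) (tri y t)] with s hs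
      exact hs.le
  filter_upwards [key] with s hs
  refine ⟨by simp [hy0, hx.1], by simp [hy1, hx.2.1], fun t ht k => ?_⟩
  rw [tri_add_smul]
  exact hs t (Finset.mem_range.2 (by omega)) k

/-- Isolates the only term that may be infinite, so that real calculus applies to the rest. -/
theorem cost_eq_sum_add {n N : ℕ} (hN : 3 ≤ N) (f : ℕ → Vec n → EReal) (x : ℕ → Vec n)
    (hf : ∀ t, 2 ≤ t → t + 2 ≤ N → ∀ y, f t y ≠ ⊤ ∧ f t y ≠ ⊥) :
    cost N f x = ((∑ t ∈ Finset.Icc 2 (N - 2), (f t (x t)).toReal : ℝ) : EReal) +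
      f (N - 1) (x (N - 1)) := by
  obtain ⟨M, rfl⟩ : ∃ M, N = M + 3 := ⟨N - 3, by omega⟩
  have h1 : M + 3 - 1 = M + 1 + 1 := by omega
  have h2 : M + 3 - 2 = M + 1 := by omega
  unfold cost
  rw [h1, h2, Finset.sum_Icc_succ_top (by omega)]
  congr 1
  have : ∀ s : Finset ℕ, s ⊆ Finset.Icc 2 (M + 1) →
      ∑ t ∈ s, f t (x t) = ((∑ t ∈ s, (f t (x t)).toReal : ℝ) : EReal) := by
    intro s
    induction s using Finset.induction_on with
    | empty => simp
    | insert a s ha ih =>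
      intro hs
      have hmem := Finset.mem_Icc.1 (hs (Finset.mem_insert_self a s))
      have hfin := hf a hmem.1 (by omega) (x a)
      rw [Finset.sum_insert ha, Finset.sum_insert ha, EReal.coe_add,
        EReal.coe_toReal hfin.1 hfin.2, ih ((Finset.subset_insert a s).trans hs)]
  exact this _ Finset.Subset.rfl

theorem eventually_cost_lt {n N : ℕ} (hN : 3 ≤ N) {f : ℕ → Vec n → EReal} {x : ℕ → Vec n}
    (hf : ∀ t, 2 ≤ t → t + 2 ≤ N → IsRealC1 (f t))
    {q : Vec n → ℝ} (hq : IsContinuousCUA (f (N - 1)) (x (N - 1)) q) {y : ℕ → Vec n}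
    (hy : ∑ t ∈ Finset.range (N - 1), inner ℝ (stageGrad f x t) (y t) + q (y (N - 1)) < 0) :
    ∀ᶠ s in 𝓝[>] (0 : ℝ), cost N f (fun t => x t + s • y t) < cost N f x := by
  set D := ∑ t ∈ Finset.range (N - 1), inner ℝ (stageGrad f x t) (y t) with hD
  have hD' : D = ∑ t ∈ Finset.Icc 2 (N - 2),
      inner ℝ (gradient (fun y => (f t y).toReal) (x t)) (y t) := by
    rw [hD]
    symm
    refine (Finset.sum_congr rfl fun t ht => ?_).trans
      (Finset.sum_subset (s₁ := Finset.Icc 2 (N - 2)) (fun t ht => ?_) fun t _ ht' => ?_)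
    · have := (Finset.mem_Icc.1 ht).1
      rw [stageGrad, if_neg (by omega)]
    · rw [Finset.mem_Icc] at ht
      rw [Finset.mem_range]; omega
    · rename_i ht
      rw [Finset.mem_Icc] at ht'
      rw [Finset.mem_range] at ht
      rw [stageGrad, if_pos (by omega), inner_zero_left]
  have hR : HasDerivAt (fun s : ℝ => ∑ t ∈ Finset.Icc 2 (N - 2), (f t (x t + s • y t)).toReal)
      D 0 := by
    rw [hD']
    refine HasDerivAt.fun_sum fun t ht => ?_
    rw [Finset.mem_Icc] at ht
    have hdiff : DifferentiableAt ℝ (fun y => (f t y).toReal) (x t) :=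
      ((hf t ht.1 (by omega)).2.differentiable (by norm_num)).differentiableAt
    have hg := hdiff.hasGradientAt.hasFDerivAt
    have hl : HasDerivAt (fun s : ℝ => x t + s • y t) (y t) 0 := by
      simpa using ((hasDerivAt_id (0 : ℝ)).smul_const (y t)).const_add (x t)
    have hx0 : x t + (0 : ℝ) • y t = x t := by simp
    rw [← hx0] at hg
    have := hg.comp_hasDerivAt (0 : ℝ) hl
    simpa using! this
  -- The slack is split: the last term rises by at most `s * c`, the smooth part by less than `-s *
  -- c`.
  obtain ⟨c, hc1, hc2⟩ := exists_between (show q (y (N - 1)) < -D by linarith)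
  have hfin : ∀ t, 2 ≤ t → t + 2 ≤ N → ∀ y, f t y ≠ ⊤ ∧ f t y ≠ ⊥ :=
    fun t h1 h2 => (hf t h1 h2).1
  filter_upwards [eventually_lt_add_mul_of_hasDerivAt hR (show D < -c by linarith),
    hq.eventually_le hc1] with s h1 h2
  rw [cost_eq_sum_add hN f _ hfin, cost_eq_sum_add hN f _ hfin]
  simp only [zero_smul, add_zero] at h1
  generalize (∑ t ∈ Finset.Icc 2 (N - 2), (f t (x t + s • y t)).toReal) = A at h1 ⊢
  generalize (∑ t ∈ Finset.Icc 2 (N - 2), (f t (x t)).toReal) = B at h1 ⊢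
  obtain ⟨a, ha⟩ : ∃ a : ℝ, f (N - 1) (x (N - 1)) = a :=
    ⟨_, (EReal.coe_toReal hq.finite_at.1 hq.finite_at.2).symm⟩
  rw [ha] at h2 ⊢
  refine (add_le_add_right h2 _).trans_lt ?_
  rw [← EReal.coe_add, ← EReal.coe_add, ← EReal.coe_add, EReal.coe_lt_coe_iff]
  linarith

/-! ### Variations of the trajectory and the multiplier rule -/

/-- The `t`-th entry of a variation of the trajectory, which vanishes for `t = 0, 1`. -/
def coord (n N t : ℕ) : (Fin (N + 1) → Vec n) →L[ℝ] Vec n :=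
  if ht : 2 ≤ t ∧ t < N + 1 then ContinuousLinearMap.proj ⟨t, ht.2⟩ else 0

/-- The triple of consecutive entries of a variation of the trajectory. -/
def triCoord (n N t : ℕ) : (Fin (N + 1) → Vec n) →L[ℝ] Triple n :=
  (coord n N t).prod ((coord n N (t + 1)).prod (coord n N (t + 2)))

theorem coord_single {n N r : ℕ} (hr : r + 2 < N + 1) (v : Vec n) (t : ℕ) :
    coord n N t (Pi.single ⟨r + 2, hr⟩ v) = if t = r + 2 then v else 0 := by
  unfold coord
  by_cases ht : t = r + 2
  · subst ht
    rw [dif_pos ⟨by omega, hr⟩]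
    simp
  · rw [if_neg ht]
    split_ifs with h
    · simp only [ContinuousLinearMap.proj_apply]
      rw [Pi.single_apply, if_neg fun h => ht (congrArg Fin.val h)]
    · simp

/-- The entry `r + 2` occurs in the triples starting at `r + 2`, `r + 1` and `r`. Near the end some
of these triples are missing, and at `N - 1` the terminal term enters, whence three cases. -/
theorem stationarity {n N : ℕ} (hN : 3 ≤ N) {a b c : ℕ → Vec n} {e : Vec n}
    (H : ∀ d, ∑ t ∈ Finset.range (N - 1), (inner ℝ (coord n N t d) (a t) +
      inner ℝ (coord n N (t + 1) d) (b t) + inner ℝ (coord n N (t + 2) d) (c t)) +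
      inner ℝ (coord n N (N - 1) d) e = 0) :
    (∀ r, r + 4 ≤ N → a (r + 2) + b (r + 1) + c r = 0) ∧
    (∀ r, r + 3 = N → b (r + 1) + c r + e = 0) ∧
    (∀ r, r + 2 = N → c r = 0) := by
  have key : ∀ r, r + 2 ≤ N → ∀ v : Vec n,
      (if r + 2 < N - 1 then inner ℝ v (a (r + 2)) else 0) +
      (if r + 1 < N - 1 then inner ℝ v (b (r + 1)) else 0) + inner ℝ v (c r) +
      (if N - 1 = r + 2 then inner ℝ v e else 0) = 0 := by
    intro r hr v
    have := H (Pi.single ⟨r + 2, by omega⟩ v)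
    simp only [coord_single, Finset.sum_add_distrib, add_left_inj,
      show ∀ t, t + 1 = r + 2 ↔ t = r + 1 from fun t => by omega] at this
    have hite : ∀ (P : Prop) [Decidable P] (y : Vec n),
        inner ℝ (if P then v else 0) y = if P then inner ℝ v y else 0 := by
      intro P _ y
      split_ifs <;> simp
    simp only [hite, Finset.sum_ite_eq', Finset.mem_range] at this
    rwa [if_pos (show r < N - 1 by omega)] at this
  refine ⟨fun r hr => ?_, fun r hr => ?_, fun r hr => ?_⟩ <;>
    refine ext_inner_left ℝ fun v => ?_ <;> have := key r (by omega) v <;>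
    rw [inner_zero_right]
  · rw [if_pos (by omega), if_pos (by omega), if_neg (by omega), add_zero] at this
    rwa [inner_add_right, inner_add_right]
  · rw [if_neg (by omega), if_pos (by omega), if_pos (by omega), zero_add] at this
    rwa [inner_add_right, inner_add_right]
  · rwa [if_neg (by omega), if_neg (by omega), if_neg (by omega), add_zero, zero_add,
      zero_add] at this

/-- Riesz representation is applied in each factor, since the product carries the sup norm. -/
theorem exists_pair_eq {n : ℕ} (φ : StrongDual ℝ (Triple n)) :
    ∃ p : Triple n, ∀ d, pair d p = φ d := by
  have rep : ∀ ψ : StrongDual ℝ (Vec n), ∃ y : Vec n, ∀ x, inner ℝ x y = ψ x := fun ψ =>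
    ⟨(InnerProductSpace.toDual ℝ (Vec n)).symm ψ, fun x => by
      rw [real_inner_comm, InnerProductSpace.toDual_symm_apply]⟩
  obtain ⟨y₁, h₁⟩ := rep (φ.comp (ContinuousLinearMap.inl ℝ (Vec n) (Vec n × Vec n)))
  obtain ⟨y₂, h₂⟩ := rep (φ.comp ((ContinuousLinearMap.inr ℝ (Vec n) (Vec n × Vec n)).comp
    (ContinuousLinearMap.inl ℝ (Vec n) (Vec n))))
  obtain ⟨y₃, h₃⟩ := rep (φ.comp ((ContinuousLinearMap.inr ℝ (Vec n) (Vec n × Vec n)).comp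
    (ContinuousLinearMap.inr ℝ (Vec n) (Vec n))))
  refine ⟨(y₁, y₂, y₃), fun d => ?_⟩
  simp only [pair, h₁, h₂, h₃, ContinuousLinearMap.comp_apply, ContinuousLinearMap.inl_apply,
    ContinuousLinearMap.inr_apply, ← map_add]
  simp

theorem pair_sum_smul {n : ℕ} {κ : Type*} (s : Finset κ) (a : κ → ℝ) (P : κ → Triple n)
    (d : Triple n) : pair d (∑ k ∈ s, a k • P k) = ∑ k ∈ s, a k * pair d (P k) := by
  simp only [pair, Prod.fst_sum, Prod.snd_sum, Prod.smul_fst, Prod.smul_snd, inner_sum,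
    real_inner_smul_right, mul_add, Finset.sum_add_distrib]

/-- The multiplier rule along variations of the trajectory. -/
theorem exists_lagrange_multipliers {n m N : ℕ} (hN : 3 ≤ N)
    {f : ℕ → Vec n → EReal} {W : Fin m → Triple n → ℝ} {v₀ v₁ : Vec n}
    {x : ℕ → Vec n} (hx : IsOptimal N f W v₀ v₁ x)
    {h : ℕ → Fin m → Triple n → ℝ}
    (hW : ∀ t, t + 2 ≤ N → ∀ k ∈ active W (tri x t),
      IsContinuousCUA (fun z => ((W k z : ℝ) : EReal)) (tri x t) (h t k))
    (hWusc : ∀ t, t + 2 ≤ N → ∀ k ∉ active W (tri x t), UpperSemicontinuousAt (W k) (tri x t))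
    (hf : ∀ t, 2 ≤ t → t + 2 ≤ N → IsRealC1 (f t))
    {q : Vec n → ℝ} (hq : IsContinuousCUA (f (N - 1)) (x (N - 1)) q) :
    ∃ (μ : ℝ) (α : ℕ → Fin m → ℝ) (ξ : Vec n) (P : ℕ → Fin m → Triple n),
      0 ≤ μ ∧ (∀ t k, 0 ≤ α t k) ∧ (∀ t, ∀ k ∉ active W (tri x t), α t k = 0) ∧
      (μ ≠ 0 ∨ ∃ t, t + 2 ≤ N ∧ ∃ k, α t k ≠ 0) ∧
      ξ ∈ subdiff q ∧
      (∀ t, t + 2 ≤ N → ∀ k ∈ active W (tri x t), P t k ∈ subdiffTriple (h t k)) ∧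
      ∀ d, ∑ t ∈ Finset.range (N - 1),
        (pair (triCoord n N t d) (∑ k ∈ active W (tri x t), α t k • P t k) +
          μ * inner ℝ (stageGrad f x t) (coord n N t d)) +
        μ * inner ℝ (coord n N (N - 1) d) ξ = 0 := by
  classical
  let J₀ : Finset (Σ _ : ℕ, Fin m) := (Finset.range (N - 1)).sigma fun t => active W (tri x t)
  have hJ₀ : ∀ i ∈ J₀, i.1 + 2 ≤ N ∧ i.2 ∈ active W (tri x i.1) := by
    intro i hi
    rw [Finset.mem_sigma, Finset.mem_range] at hi
    exact ⟨by omega, hi.2⟩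
  let smooth : StrongDual ℝ (Fin (N + 1) → Vec n) :=
    ∑ t ∈ Finset.range (N - 1), (innerSL ℝ (stageGrad f x t)).comp (coord n N t)
  have hsmooth : ∀ d, smooth d =
      ∑ t ∈ Finset.range (N - 1), inner ℝ (stageGrad f x t) (coord n N t d) := by
    intro d
    simp [smooth]
  let costPull : StrongDual ℝ (Vec n) →L[ℝ] StrongDual ℝ (Fin (N + 1) → Vec n) :=
    (ContinuousLinearMap.compL ℝ (Fin (N + 1) → Vec n) (Vec n) ℝ).flip (coord n N (N - 1))
  let triPull (t : ℕ) : StrongDual ℝ (Triple n) →L[ℝ] StrongDual ℝ (Fin (N + 1) → Vec n) :=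
    (ContinuousLinearMap.compL ℝ (Fin (N + 1) → Vec n) (Triple n) ℝ).flip (triCoord n N t)
  -- `none` indexes the cost, its pulled-back subdifferential translated by the smooth gradient;
  -- `some ⟨t, k⟩` indexes an active constraint.
  let S : Option (Σ _ : ℕ, Fin m) → Set (StrongDual ℝ (Fin (N + 1) → Vec n)) := fun i =>
    i.elim ((fun φ => smooth + φ) '' (costPull '' dualSubdiff q))
      (fun i => triPull i.1 '' dualSubdiff (h i.1 i.2))
  have hforall : ∀ {R : Option (Σ _ : ℕ, Fin m) → Prop}, R none → (∀ i ∈ J₀, R (some i)) →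
      ∀ i ∈ Finset.insertNone J₀, R i := by
    rintro R h1 h2 (_ | i) hi
    exacts [h1, h2 i (Finset.some_mem_insertNone.1 hi)]
  have hcua := fun i (hi : i ∈ J₀) => hW i.1 (hJ₀ i hi).1 i.2 (hJ₀ i hi).2
  obtain ⟨w, φ, hw, hwne, hφ, hsum⟩ := exists_multipliers_finset (Finset.insertNone J₀) (S := S)
    (hforall
      (((convex_dualSubdiff q).linear_image costPull.toLinearMap).translate smooth)
      (fun i _ => (convex_dualSubdiff (h i.1 i.2)).linear_image (triPull i.1).toLinearMap))
    (hforall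
      (((isCompact_dualSubdiff hq.continuous hq.pos_homogeneous).image
        costPull.continuous).image (continuous_const.add continuous_id))
      (fun i hi => (isCompact_dualSubdiff (hcua i hi).continuous
        (hcua i hi).pos_homogeneous).image (triPull i.1).continuous))
    (hforall
      (by
        obtain ⟨φ, hφ, -⟩ := exists_mem_dualSubdiff_apply_eq hq.convex hq.pos_homogeneous 0
        exact ⟨_, mem_image_of_mem _ (mem_image_of_mem _ hφ)⟩)
      (fun i hi => by
        obtain ⟨φ, hφ, -⟩ :=
          exists_mem_dualSubdiff_apply_eq (hcua i hi).convex (hcua i hi).pos_homogeneous 0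
        exact ⟨_, mem_image_of_mem _ hφ⟩))
    -- If all functionals were negative at `d`, so would be the maximizing ones, whose values are
    -- the sublinear functions themselves; then `d` is a feasible descent direction.
    (fun d => by
      by_contra! hneg
      have hcost := hneg none Finset.none_mem_insertNone
      have hcon : ∀ i ∈ J₀, ∀ φ ∈ S (some i), φ d < 0 := fun i hi =>
        hneg (some i) (Finset.some_mem_insertNone.2 hi)
      have h1 : ∑ t ∈ Finset.range (N - 1), inner ℝ (stageGrad f x t) (coord n N t d) +
          q (coord n N (N - 1) d) < 0 := by
        obtain ⟨φ, hφ, hval⟩ := exists_mem_dualSubdiff_apply_eq hq.convex hq.pos_homogeneous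
          (coord n N (N - 1) d)
        rw [← hval, ← hsmooth]
        exact hcost _ (mem_image_of_mem _ (mem_image_of_mem _ hφ))
      have h2 : ∀ t, t + 2 ≤ N → ∀ k ∈ active W (tri x t),
          h t k (tri (fun t => coord n N t d) t) < 0 := by
        intro t ht k hk
        have hi : (⟨t, k⟩ : Σ _ : ℕ, Fin m) ∈ J₀ :=
          Finset.mem_sigma.2 ⟨Finset.mem_range.2 (show t < N - 1 by omega), hk⟩
        obtain ⟨φ, hφ, hval⟩ := exists_mem_dualSubdiff_apply_eq (hcua _ hi).convex
          (hcua _ hi).pos_homogeneous (triCoord n N t d)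
        have := hcon _ hi _ (mem_image_of_mem _ hφ)
        exact hval.symm.trans_lt this
      obtain ⟨s, hfeas, hlt⟩ := ((eventually_isFeasible hx.1 hW hWusc
        (by simp [coord]) (by simp [coord]) h2).and (eventually_cost_lt hN hf hq h1)).exists
      exact (hx.2 _ hfeas).not_gt hlt)
  obtain ⟨_, ⟨ψ, hψ, rfl⟩, hψ'⟩ := hφ none Finset.none_mem_insertNone
  have hrep : ∀ t k, ∃ p : Triple n, t + 2 ≤ N → k ∈ active W (tri x t) →
      p ∈ subdiffTriple (h t k) ∧ ∀ d, pair (triCoord n N t d) p = φ (some ⟨t, k⟩) d := by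
    intro t k
    by_cases hi : (⟨t, k⟩ : Σ _ : ℕ, Fin m) ∈ J₀
    · obtain ⟨χ, hχ, hχ'⟩ := hφ _ (Finset.some_mem_insertNone.2 hi)
      obtain ⟨p, hp⟩ := exists_pair_eq χ
      refine ⟨p, fun _ _ => ⟨fun d => (hp d).trans_le (hχ d), fun d => ?_⟩⟩
      rw [hp, ← hχ']
      rfl
    · refine ⟨0, fun ht hk => absurd ?_ hi⟩
      exact Finset.mem_sigma.2 ⟨Finset.mem_range.2 (show t < N - 1 by omega), hk⟩
  choose P hP using hrep
  refine ⟨w none, fun t k => if k ∈ active W (tri x t) then w (some ⟨t, k⟩) else 0,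
    (InnerProductSpace.toDual ℝ (Vec n)).symm ψ, P, hw none, fun t k => ?_, fun t k hk => if_neg hk,
    ?_, fun d => ?_, fun t ht k hk => (hP t k ht hk).1, fun d => ?_⟩
  · dsimp only
    split_ifs
    exacts [hw _, le_rfl]
  · obtain ⟨i, hi, hne⟩ := hwne
    rcases i with _ | ⟨t, k⟩
    · exact Or.inl hne
    · obtain ⟨ht, hk⟩ := hJ₀ _ (Finset.some_mem_insertNone.1 hi)
      exact Or.inr ⟨t, ht, k, (if_pos hk).trans_ne hne⟩
  · rw [real_inner_comm, InnerProductSpace.toDual_symm_apply]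
    exact hψ d
  · have hd := congrArg (fun T : StrongDual ℝ (Fin (N + 1) → Vec n) => T d) hsum
    simp only [Finset.sum_insertNone, add_apply,
      smul_apply, sum_apply, smul_eq_mul,
      zero_apply] at hd
    have hcost : φ none d = ∑ t ∈ Finset.range (N - 1),
        inner ℝ (stageGrad f x t) (coord n N t d) + ψ (coord n N (N - 1) d) := by
      rw [← hψ', ← hsmooth]
      rfl
    rw [hcost, Finset.sum_sigma] at hd
    rw [real_inner_comm, InnerProductSpace.toDual_symm_apply, Finset.sum_add_distrib,
      ← Finset.mul_sum]
    have : ∀ t ∈ Finset.range (N - 1),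
        pair (triCoord n N t d) (∑ k ∈ active W (tri x t),
          (if k ∈ active W (tri x t) then w (some ⟨t, k⟩) else 0) • P t k) =
        ∑ k ∈ active W (tri x t), w (some ⟨t, k⟩) * φ (some ⟨t, k⟩) d := by
      intro t ht
      rw [Finset.mem_range] at ht
      rw [pair_sum_smul]
      exact Finset.sum_congr rfl fun k hk => by
        rw [if_pos hk, (hP t k (by omega) hk).2]
    rw [Finset.sum_congr rfl this]
    linarith

/-- A Slater direction excludes nontrivial nonnegative combinations of subgradients that vanish. -/
theorem eq_zero_of_sum_smul_subdiff_eq_zero {n : ℕ} {κ : Type*} {s : Finset κ} {a : κ → ℝ}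
    {P : κ → Triple n} {g : κ → Triple n → ℝ} (ha : ∀ k ∈ s, 0 ≤ a k)
    (hP : ∀ k ∈ s, P k ∈ subdiffTriple (g k)) {z : Triple n} (hz : ∀ k ∈ s, g k z < 0)
    (hsum : ∑ k ∈ s, a k • P k = 0) : ∀ k ∈ s, a k = 0 := by
  have h0 : ∑ k ∈ s, a k * pair z (P k) = 0 := by
    rw [← pair_sum_smul, hsum]
    simp [pair]
  have hneg : ∀ k ∈ s, pair z (P k) < 0 := fun k hk => (hP k hk z).trans_lt (hz k hk)
  intro k hk
  have := (Finset.sum_eq_zero_iff_of_nonpos fun k hk =>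
    mul_nonpos_of_nonneg_of_nonpos (ha k hk) (hneg k hk).le).1 h0 k hk
  exact (mul_eq_zero.1 this).resolve_right (hneg k hk).ne

theorem sum_smul_mem_sum_smul_subdiffTriple {n : ℕ} {κ : Type*} {s : Finset κ} {a : κ → ℝ}
    {P : κ → Triple n} {g : κ → Triple n → ℝ} (hP : ∀ k ∈ s, P k ∈ subdiffTriple (g k)) :
    ∑ k ∈ s, a k • P k ∈ ∑ k ∈ s, a k • subdiffTriple (g k) :=
  Set.finsetSum_mem_finsetSum s _ _ fun k hk => Set.smul_mem_smul_set (hP k hk)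

theorem nonempty_subdiffTriple {n : ℕ} {W : Triple n → EReal} {z : Triple n} {h : Triple n → ℝ}
    (hW : IsContinuousCUA W z h) : (subdiffTriple h).Nonempty := by
  obtain ⟨φ, hφ, -⟩ := exists_mem_dualSubdiff_apply_eq hW.convex hW.pos_homogeneous 0
  obtain ⟨p, hp⟩ := exists_pair_eq φ
  exact ⟨p, fun d => (hp d).trans_le (hφ d)⟩

theorem nonempty_subdiff {n : ℕ} {f : Vec n → EReal} {x : Vec n} {q : Vec n → ℝ}
    (hq : IsContinuousCUA f x q) : (subdiff q).Nonempty := by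
  obtain ⟨φ, hφ, -⟩ := exists_mem_dualSubdiff_apply_eq hq.convex hq.pos_homogeneous 0
  refine ⟨(InnerProductSpace.toDual ℝ (Vec n)).symm φ, fun d => ?_⟩
  rw [real_inner_comm, InnerProductSpace.toDual_symm_apply]
  exact hφ d

/-! ### Adjoint vectors and the main theorem -/

theorem theorem3p2 (n m N : ℕ) (hN : 2 ≤ N)
    (f : ℕ → Vec n → EReal) (W : Fin m → Triple n → ℝ) (v₀ v₁ : Vec n)
    -- the optimal trajectory
    (x : ℕ → Vec n) (hx : IsOptimal N f W v₀ v₁ x)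
    -- the cones of tangent directions are local tents
    (K : ℕ → ConvexCone ℝ (Triple n))
    (hK : ∀ t, t + 2 ≤ N → IsLocalTent (constraintSet W) (tri x t) (K t))
    -- continuous CUAs of the active constraints; the inactive ones are upper semicontinuous
    -- (as they are when they are continuous, and also when they have a continuous CUA)
    (h : ℕ → Fin m → Triple n → ℝ)
    (hW : ∀ t, t + 2 ≤ N → ∀ k ∈ active W (tri x t),
      IsContinuousCUA (fun z => ((W k z : ℝ) : EReal)) (tri x t) (h t k))
    (hWusc : ∀ t, t + 2 ≤ N → ∀ k ∉ active W (tri x t), UpperSemicontinuousAt (W k) (tri x t))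
    -- the cost
    (hf : ∀ t, 2 ≤ t → t + 2 ≤ N → IsRealC1 (f t))
    (q : Vec n → ℝ) (hq : IsContinuousCUA (f (N - 1)) (x (N - 1)) q)
    -- Slater-type directions
    (hSlater : ∀ t, t + 2 ≤ N → ∃ z, ∀ k ∈ active W (tri x t), h t k z < 0) :
    ∃ (μ : ℝ) (α : ℕ → Fin m → ℝ) (p u : ℕ → Vec n),
      0 ≤ μ ∧
      (∀ t, t + 2 ≤ N → ∀ k, 0 ≤ α t k) ∧
      -- not all zero
      (μ ≠ 0 ∨ (∃ t k, 2 ≤ t ∧ t + 2 ≤ N ∧ α t k ≠ 0) ∨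
        (∃ t, t ≤ N ∧ p t ≠ 0) ∨ (∃ t, t + 1 ≤ N ∧ u t ≠ 0)) ∧
      -- adjoint inclusions
      (∀ t, t + 2 ≤ N →
        (p t - u t - μ • stageGrad f x t, u (t + 1), -p (t + 2)) ∈
          ∑ k ∈ active W (tri x t), α t k • subdiffTriple (h t k)) ∧
      -- complementary slackness
      (∀ t, t + 2 ≤ N → ∀ k, α t k * W k (tri x t) = 0) ∧
      -- boundary conditions
      u 0 = 0 ∧
      p (N - 1) - u (N - 1) ∈ μ • subdiff q ∧
      p N = 0 := by
  rcases hN.eq_or_lt with rfl | hN3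
  -- For `N = 2` the cost sum is empty, so `μ = 1` works with `α = 0`, `u = 0` and `p 1` any
  -- subgradient.
  · obtain ⟨ξ, hξ⟩ := nonempty_subdiff hq
    refine ⟨1, 0, fun t => if t = 1 then ξ else 0, 0, zero_le_one, fun _ _ _ => le_rfl,
      Or.inl one_ne_zero, fun t ht => ?_, fun _ _ _ => by simp, rfl, ?_, by simp⟩
    · obtain rfl : t = 0 := by omega
      choose! P hP using fun k hk => nonempty_subdiffTriple (hW 0 ht k hk)
      have := sum_smul_mem_sum_smul_subdiffTriple (a := fun _ => (0 : ℝ)) hP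
      simpa [stageGrad] using! this
    · simpa using hξ
  · obtain ⟨μ, α, ξ, P, hμ, hα, hinact, hne, hξ, hP, hstat⟩ :=
      exists_lagrange_multipliers hN3 hx hW hWusc hf hq
    set A : ℕ → Triple n := fun t => ∑ k ∈ active W (tri x t), α t k • P t k with hA
    let u : ℕ → Vec n := fun t => t.casesOn 0 fun t => (A t).2.1
    -- The initial entries are fixed, so no Euler equation constrains indices `0` and `1`; there `p`
    -- is chosen to make the first component of the inclusion hold.
    let p : ℕ → Vec n := fun t => if t < 2 then (A t).1 + u t else -(A (t - 2)).2.2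
    have hp : ∀ t, p (t + 2) = -(A t).2.2 := fun t => by simp [p]
    obtain ⟨h1, h2, h3⟩ := stationarity hN3 (a := fun t => (A t).1 + μ • stageGrad f x t)
      (b := fun t => (A t).2.1) (c := fun t => (A t).2.2) (e := μ • ξ) (fun d => by
        rw [← hstat d, real_inner_smul_right]
        congr 1
        refine Finset.sum_congr rfl fun t _ => ?_
        rw [inner_add_right, real_inner_smul_right, real_inner_comm (stageGrad f x t)]
        simp only [pair, triCoord, ContinuousLinearMap.prod_apply, hA]
        ring)
    have hfirst : ∀ t, t + 2 ≤ N → p t - u t - μ • stageGrad f x t = (A t).1 := by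
      intro t ht
      by_cases ht2 : t < 2
      · simp only [p, stageGrad, if_pos ht2, smul_zero, sub_zero, add_sub_cancel_right]
      · obtain ⟨r, rfl⟩ : ∃ r, t = r + 2 := ⟨t - 2, by omega⟩
        have h := h1 r (by omega)
        rw [hp, sub_sub, sub_eq_iff_eq_add, neg_eq_iff_add_eq_zero]
        change (A r).2.2 + ((A (r + 2)).1 + ((A (r + 1)).2.1 + μ • stageGrad f x (r + 2))) = 0
        rw [← h]
        abel
    have htriple : ∀ t, t + 2 ≤ N →
        (p t - u t - μ • stageGrad f x t, u (t + 1), -p (t + 2)) = A t := by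
      intro t ht
      rw [hfirst t ht, hp, neg_neg]
    refine ⟨μ, α, p, u, hμ, fun t _ k => hα t k, ?_, fun t ht => ?_, fun t _ k => ?_, rfl, ?_, ?_⟩
    · by_contra! hall
      obtain ⟨hμ0, -, hp0, hu0⟩ := hall
      rcases hne with hne | ⟨t, ht, k, hk⟩
      · exact hne hμ0
      -- All components of `A t` are built from `μ`, `p` and `u`, so this covers `t = 0, 1` too,
      -- whose multipliers are absent from the nontriviality claim.
      · have hAt : A t = 0 := by
          rw [← htriple t ht, hp0 t (by omega), hp0 (t + 2) ht, hu0 t (by omega),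
            hu0 (t + 1) (by omega), hμ0]
          simp
        obtain ⟨z, hz⟩ := hSlater t ht
        by_cases hact : k ∈ active W (tri x t)
        · exact hk (eq_zero_of_sum_smul_subdiff_eq_zero (fun k _ => hα t k) (hP t ht) hz hAt k hact)
        · exact hk (hinact t k hact)
    · rw [htriple t ht]
      exact sum_smul_mem_sum_smul_subdiffTriple (hP t ht)
    · by_cases hact : k ∈ active W (tri x t)
      · rw [show W k (tri x t) = 0 by simpa [active] using hact, mul_zero]
      · rw [hinact t k hact, zero_mul]
    · obtain ⟨r, rfl⟩ : ∃ r, N = r + 3 := ⟨N - 3, by omega⟩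
      have h := h2 r rfl
      have heq : p (r + 3 - 1) - u (r + 3 - 1) = μ • ξ := by
        change p (r + 2) - (A (r + 1)).2.1 = μ • ξ
        rw [hp, sub_eq_iff_eq_add, neg_eq_iff_add_eq_zero, ← h]
        abel
      rw [heq]
      exact Set.smul_mem_smul_set hξ
    · obtain ⟨r, rfl⟩ : ∃ r, N = r + 2 := ⟨N - 2, by omega⟩
      rw [hp, h3 r rfl, neg_zero]
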